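/- Let $n \ge 8$ be an even integer. There is an integer $N$, depending only on $n$, such that the following holds for every integer $d$ with $d-2 \ge N$, $d \ge 2$ and $d-2$ divisible by $n+1$. Let $K$ be any field of characteristic zero, let $R = K[x_0,\ldots,x_n]$ with its standard grading, and let $L = a_0x_0+\cdots+a_nx_n \in R$ be a linear form all of whose coefficients are nonzero (that is, $x_0,\ldots,x_n,L$ are in linearly general position; in particular a general linear form $L$ is of this kind). Then the graded Artinian algebra $A = R/(x_0^d,\ldots,x_n^d,L^d)$ fails the weak Lefschetz property: for every linear form $\ell \in [A]_1$ there is an integer $j \ge 0$ such that the multiplication map $\times\ell\colon [A]_j \to [A]_{j+1}$ does not have maximal rank, i.e. is neither injective nor surjective. -/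

import Mathlib

open MvPolynomial

/-- The degree `j` component `[R/I]_j` of the quotient of the standard graded polynomial ring
`R = K[x_i : i ∈ σ]` by an ideal `I`: the image in `R/I` of the space of forms of degree `j`.
(It is meant for homogeneous ideals `I`.) -/
noncomputable def quotientComponent {σ K : Type*} [Field K] (I : Ideal (MvPolynomial σ K)) (j : ℕ) :
    Submodule K (MvPolynomial σ K ⧸ I) :=
  (homogeneousSubmodule σ K j).map (Ideal.Quotient.mkₐ K I).toLinearMap

/-- Multiplication by `ℓ` from degree `j` to degree `j + 1` has maximal rank, that is, the
`K`-linear map `[A]_j → [A]_{j+1}`, `a ↦ ℓ * a`, is injective or surjective. -/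
def MulHasMaximalRank {K A : Type*} [Field K] [CommRing A] [Algebra K A]
    (𝒜 : ℕ → Submodule K A) (ℓ : A) (j : ℕ) : Prop :=
  (∀ a ∈ 𝒜 j, ℓ * a = 0 → a = 0) ∨ (∀ b ∈ 𝒜 (j + 1), ∃ a ∈ 𝒜 j, ℓ * a = b)

/-- The weak Lefschetz property of an algebra `A` with graded components `𝒜 j`: there is a
linear form `ℓ ∈ [A]_1` such that multiplication by `ℓ` has maximal rank from each degree to
the next. -/
def HasWeakLefschetzProperty {K A : Type*} [Field K] [CommRing A] [Algebra K A]
    (𝒜 : ℕ → Submodule K A) : Prop :=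
  ∃ ℓ ∈ 𝒜 1, ∀ j : ℕ, MulHasMaximalRank 𝒜 ℓ j

/-- The linear form `a_0 x_0 + ⋯ + a_n x_n`. -/
noncomputable def linearForm {n : ℕ} {K : Type*} [Field K] (a : Fin (n + 1) → K) :
    MvPolynomial (Fin (n + 1)) K :=
  ∑ i, C (a i) * X i

/-- The ideal `(x_0^d, …, x_n^d, L^d)` of `K[x_0, …, x_n]`. -/
noncomputable def uniformPowerIdeal {n : ℕ} {K : Type*} [Field K] (L : MvPolynomial (Fin (n + 1)) K) (d : ℕ) :
    Ideal (MvPolynomial (Fin (n + 1)) K) :=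
  Ideal.span (Set.range (fun i : Fin (n + 1) => (X i : MvPolynomial (Fin (n + 1)) K) ^ d) ∪ {L ^ d})

/-! Write `n = 2r + 2`, so that there are `2r + 3` variables, `d = k(2r + 3) + 2` and `j = (r +
1)(k(2r + 4) + 1)`. Every linear form `ℓ` fails to have maximal rank from degree `j - 1` to degree
`j`.

Injectivity fails because the Hilbert function drops there. In characteristic zero `K[x_i]/(x_i ^
d)` has the strong Lefschetz property for `L`, by an `sl₂`-argument
(`mem_varPowIdeal_of_linForm_pow_mul_mem`), so `[A]_j` has dimension `boxCount j - boxCount (j -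
d)`, while `[A]_{j-1}` has at least the analogous dimension. The drop is thus an inequality between
numbers of lattice points (`boxCount_difference_lt`), which follows from log-concavity of
`boxCount`.

Surjectivity fails because `A/ℓA` is nonzero in degree `j`. With one more variable, `A` becomes
`K[z]/(z_o ^ d, ∑ z_o)` in `2r + 4` variables and `ℓ` becomes `∑ p_o z_o`. By apolarity it is enough
to find a nonzero form `F` of degree `j`, of degree less than `d` in each variable, killed by `∑
∂_o` and `∑ p_o ∂_o`. For each variable `i` there is a multilinear `Q_i` of degree `r + 1` in the
other `2r + 3` variables killed by both derivations (`exists_isInvariantFamily`), and `F = (∏ Q_i) ^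
k * Q_{i₀}` has exactly the required degrees (`exists_dual_form`). -/

/-! ### Lattice points in a box: log-concavity and the numerical drop -/

/-- The number of functions `Fin m → {0, …, d - 1}` whose values add up to `j`. -/
def boxCount (d m : ℕ) (j : ℤ) : ℤ :=
  ∑ f : Fin m → Fin d, if ∑ i, ((f i : ℕ) : ℤ) = j then 1 else 0

theorem boxCount_zero (d : ℕ) (j : ℤ) : boxCount d 0 j = if j = 0 then 1 else 0 := by
  simp [boxCount, eq_comm]

theorem boxCount_succ (d m : ℕ) (j : ℤ) :
    boxCount d (m + 1) j = ∑ i ∈ Finset.range d, boxCount d m (j - i) := by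
  rw [Finset.sum_range fun i : ℕ => boxCount d m (j - i)]
  unfold boxCount
  rw [← (Fin.consEquiv fun _ : Fin (m + 1) => Fin d).sum_comp, Fintype.sum_prod_type]
  refine Finset.sum_congr rfl fun a _ => Finset.sum_congr rfl fun f _ => ?_
  simp [Fin.consEquiv, Fin.sum_univ_succ, eq_sub_iff_add_eq, add_comm]

theorem boxCount_nonneg (d m : ℕ) (j : ℤ) : 0 ≤ boxCount d m j :=
  Finset.sum_nonneg fun _ _ => by split_ifs <;> norm_num

/-- By `boxCount_succ` the count is a sum over a window of length `d`; adjacent windows differ only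
at their ends. -/
theorem boxCount_succ_sub (d m : ℕ) (j : ℤ) :
    boxCount d (m + 1) j - boxCount d (m + 1) (j - 1) = boxCount d m j - boxCount d m (j - d) := by
  have h1 := Finset.sum_range_succ (fun i : ℕ => boxCount d m (j - i)) d
  have h2 := Finset.sum_range_succ' (fun i : ℕ => boxCount d m (j - i)) d
  have h3 : ∑ i ∈ Finset.range d, boxCount d m (j - (i + 1 : ℕ)) =
      ∑ i ∈ Finset.range d, boxCount d m (j - 1 - i) :=
    Finset.sum_congr rfl fun i _ => by congr 1; push_cast; ring
  rw [h3] at h2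
  rw [boxCount_succ, boxCount_succ]
  simp only [Nat.cast_zero, sub_zero] at h2
  linarith

theorem boxCount_symm {d : ℕ} (hd : 1 ≤ d) (m : ℕ) (j : ℤ) :
    boxCount d m (m * (d - 1) - j) = boxCount d m j := by
  induction m generalizing j with
  | zero => simp [boxCount_zero]
  | succ m ih =>
    rw [boxCount_succ, boxCount_succ, ← Finset.sum_range_reflect]
    refine Finset.sum_congr rfl fun i hi => ?_
    rw [← ih]
    congr 1
    have := Finset.mem_range.1 hi
    push_cast [show i ≤ d - 1 by omega, hd]
    ring

/-- Log-concavity: convolving with the indicator of an interval preserves it. -/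
theorem boxCount_mul_le (d m : ℕ) {x y z t : ℤ} (hy : x ≤ y) (hz : x ≤ z) (h : x + t = y + z) :
    boxCount d m x * boxCount d m t ≤ boxCount d m y * boxCount d m z := by
  induction m generalizing x y z t with
  | zero =>
    simp only [boxCount_zero]
    by_cases hx : x = 0
    · by_cases ht : t = 0
      · rw [if_pos (show y = 0 by omega), if_pos (show z = 0 by omega)]; split_ifs; norm_num
      · simp only [ht, if_false, mul_zero]; split_ifs <;> norm_num
    · simp only [hx, if_false, zero_mul]; split_ifs <;> norm_num
  | succ m ih =>
    have step : ∀ p q : ℤ, p ≤ q + 1 →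
        boxCount d (m + 1) (p - 1) * boxCount d (m + 1) (q + 1) ≤
          boxCount d (m + 1) p * boxCount d (m + 1) q := by
      intro p q hpq
      have e1 := boxCount_succ_sub d m p
      have e2 := boxCount_succ_sub d m (q + 1)
      rw [add_sub_cancel_right] at e2
      -- After expanding `p` around `p - 1` and `q + 1` around `q`, the claim is the sum of `i1` and
      -- `i2`; each holds termwise in the window sum by induction.
      have i1 : boxCount d (m + 1) (p - 1) * boxCount d m (q + 1) ≤
          boxCount d (m + 1) q * boxCount d m p := by
        rw [boxCount_succ, boxCount_succ, Finset.sum_mul, Finset.sum_mul]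
        refine Finset.sum_le_sum fun i _ => ih ?_ ?_ ?_ <;> omega
      have i2 : boxCount d (m + 1) q * boxCount d m (p - d) ≤
          boxCount d (m + 1) (p - 1) * boxCount d m (q + 1 - d) := by
        rw [boxCount_succ, boxCount_succ, Finset.sum_mul, Finset.sum_mul]
        refine Finset.sum_le_sum fun i hi => ?_
        have := Finset.mem_range.1 hi
        rw [mul_comm]
        refine (ih (y := p - 1 - i) (z := q + 1 - d) ?_ ?_ ?_) <;> omega
      have e3 : boxCount d (m + 1) (q + 1) =
          boxCount d (m + 1) q + (boxCount d m (q + 1) - boxCount d m (q + 1 - d)) := by linarith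
      have e4 : boxCount d (m + 1) p =
          boxCount d (m + 1) (p - 1) + (boxCount d m p - boxCount d m (p - d)) := by linarith
      rw [e3, e4]
      linarith
    have main : ∀ (a : ℕ) (x z : ℤ), x ≤ z →
        boxCount d (m + 1) x * boxCount d (m + 1) (z + a) ≤
          boxCount d (m + 1) (x + a) * boxCount d (m + 1) z := by
      intro a
      induction a with
      | zero => intro x z _; simp
      | succ a iha =>
        intro x z hxz
        rcases hxz.eq_or_lt with rfl | hxz
        · rw [mul_comm]
        have h1 := step (x + 1) (z + a) (by omega)
        have h2 := iha (x + 1) z (by omega)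
        rw [add_sub_cancel_right] at h1
        have r1 : x + ((a + 1 : ℕ) : ℤ) = x + 1 + a := by push_cast; ring
        have r2 : z + ((a + 1 : ℕ) : ℤ) = z + a + 1 := by push_cast; ring
        rw [r1, r2]
        exact h1.trans h2
    obtain ⟨a, ha⟩ := Int.eq_ofNat_of_zero_le (sub_nonneg.2 hy)
    have h1 := main a x z (by omega)
    rwa [show z + (a : ℤ) = t by omega, show x + (a : ℤ) = y by omega] at h1

/-- Unimodality: log-concavity applied to `y`, `t` and their mirror images compares the squares of
the two counts. -/
theorem boxCount_le {d : ℕ} (hd : 1 ≤ d) (m : ℕ) {y t : ℤ} (h1 : y ≤ t)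
    (h2 : m * (d - 1) - t ≤ y) : boxCount d m t ≤ boxCount d m y := by
  have h := boxCount_mul_le d m (x := m * (d - 1) - t) (t := t) (y := y) (z := m * (d - 1) - y)
    h2 (by linarith) (by ring)
  rw [boxCount_symm hd, boxCount_symm hd] at h
  exact (mul_self_le_mul_self_iff (boxCount_nonneg _ _ _) (boxCount_nonneg _ _ _)).2 h

theorem boxCount_pos {d : ℕ} (hd : 1 ≤ d) (m : ℕ) {j : ℤ} (h1 : 0 ≤ j) (h2 : j ≤ m * (d - 1)) :
    0 < boxCount d m j := by
  induction m generalizing j with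
  | zero =>
    have : j = 0 := by simp at h2; omega
    simp [boxCount_zero, this]
  | succ m ih =>
    rw [boxCount_succ]
    refine Finset.sum_pos' (fun _ _ => boxCount_nonneg _ _ _) ?_
    push_cast at h2
    rcases le_total j (d - 1) with h | h
    · refine ⟨j.toNat, Finset.mem_range.2 (by omega), ih (by omega) ?_⟩
      rw [Int.toNat_of_nonneg h1, sub_self]
      exact mul_nonneg (by positivity) (by omega)
    · refine ⟨d - 1, Finset.mem_range.2 (by omega), ih ?_ ?_⟩ <;> push_cast [hd] <;> linarith

/-- Strictness passes through the window sum: all terms compare weakly by unimodality, and some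
shift `i` brings `y - i` into the range of the induction hypothesis. -/
theorem boxCount_add_lt {d : ℕ} (hd : 1 ≤ d) (m : ℕ) {y : ℤ} (h1 : m * (d - 1) ≤ 2 * y)
    (h2 : y ≤ m * (d - 1)) : boxCount d m (y + d) < boxCount d m y := by
  induction m generalizing y with
  | zero =>
    have : y = 0 := by simp at h1 h2; omega
    simp [boxCount_zero, this, show d ≠ 0 by omega]
  | succ m ih =>
    rw [boxCount_succ, boxCount_succ]
    push_cast at h1 h2
    have hm : (0 : ℤ) ≤ m * (d - 1) := mul_nonneg (by positivity) (by omega)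
    refine Finset.sum_lt_sum (fun i hi => ?_) ?_
    · have := Finset.mem_range.1 hi
      refine boxCount_le hd m (by omega) ?_
      nlinarith
    · obtain ⟨i, hi, hi1, hi2⟩ : ∃ i : ℕ, i < d ∧ (m : ℤ) * (d - 1) ≤ 2 * (y - i) ∧
          y - i ≤ (m : ℤ) * (d - 1) := by
        rcases le_total y (m * (d - 1)) with h | h
        · exact ⟨0, by omega, by push_cast; nlinarith, by simpa using h⟩
        · refine ⟨(y - m * (d - 1)).toNat, ?_, ?_, ?_⟩
          · zify
            rw [Int.toNat_of_nonneg (by linarith)]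
            linarith
          all_goals rw [Int.toNat_of_nonneg (by linarith)]; linarith
      refine ⟨i, Finset.mem_range.2 hi, ?_⟩
      have := ih hi1 hi2
      rwa [sub_add_eq_add_sub] at this

/-- The window ending at `y` is covered by the two adjacent windows ending at `t` and `t - d`, and
`t - d` is at least as far from the centre as `t`. -/
theorem boxCount_le_two_mul {d : ℕ} (hd : 1 ≤ d) (m : ℕ) {y t : ℤ} (h1 : y ≤ t) (h2 : t - d ≤ y)
    (h3 : 2 * t ≤ (m + 1) * (d - 1) + d) :
    boxCount d (m + 1) y ≤ 2 * boxCount d (m + 1) t := by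
  have hle : boxCount d (m + 1) (t - d) ≤ boxCount d (m + 1) t := by
    rw [← boxCount_symm hd (m + 1) (t - d)]
    refine boxCount_le hd (m + 1) ?_ ?_ <;> push_cast <;> linarith
  have key : boxCount d (m + 1) y ≤ boxCount d (m + 1) t + boxCount d (m + 1) (t - d) := by
    obtain ⟨a, rfl⟩ : ∃ a : ℕ, y = t - a := ⟨(t - y).toNat, by omega⟩
    have e : boxCount d (m + 1) t + boxCount d (m + 1) (t - d) =
        ∑ i ∈ Finset.range (d + d), boxCount d m (t - i) := by
      rw [Finset.sum_range_add, boxCount_succ, boxCount_succ]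
      congr 1
      exact Finset.sum_congr rfl fun i _ => by congr 1; push_cast; ring
    rw [e, boxCount_succ, show d + d = a + d + (d - a) by omega, Finset.sum_range_add _ (a + d),
      Finset.sum_range_add]
    have : ∑ i ∈ Finset.range d, boxCount d m (t - a - i) =
        ∑ i ∈ Finset.range d, boxCount d m (t - (a + i : ℕ)) :=
      Finset.sum_congr rfl fun i _ => by congr 1; push_cast; ring
    rw [this]
    have p1 := Finset.sum_nonneg fun i (_ : i ∈ Finset.range a) => boxCount_nonneg d m (t - i)
    have p2 := Finset.sum_nonneg fun i (_ : i ∈ Finset.range (d - a)) =>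
      boxCount_nonneg d m (t - (a + d + i : ℕ))
    linarith
  linarith

theorem boxCount_sub_eq_sum (d m : ℕ) (a : ℤ) (r : ℕ) :
    boxCount d (m + 1) (a + d) - boxCount d (m + 1) (a + d + r) =
      ∑ i ∈ Finset.range r, (boxCount d m (a + 1 + i) - boxCount d m (a + 1 + i + d)) := by
  induction r with
  | zero => simp
  | succ r ih =>
    rw [Finset.sum_range_succ, ← ih]
    have h := boxCount_succ_sub d m (a + d + r + 1)
    rw [add_sub_cancel_right] at h
    rw [show a + 1 + (r : ℤ) = a + d + r + 1 - d by ring,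
      show a + d + r + 1 - d + (d : ℤ) = a + d + r + 1 by ring]
    push_cast
    rw [← add_assoc]
    linarith

/-- Reflected to the right of the centre `Z`, the claim says that the drop over the `k + 2` steps
ending at `Z + D` is less than the drop over the next `d` steps. A unit step drops by `v y - v (y +
d)`, with `v` the count in one variable fewer. By log-concavity the relative drop `1 - v (y + d) / v
y` increases with `y`, so comparing both sides with its value at `H` leaves a comparison of sums of
`v`. -/
theorem boxCount_second_difference {s k d : ℕ} (hs : 4 ≤ s) (hk : 3 ≤ k)
    (hd : d = k * (2 * s + 1) + 2) :
    boxCount d (2 * s) (s * (d - 1) - (k * (s + 1) + 2) + d) +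
      boxCount d (2 * s) (s * (d - 1) - (k * (s + 1) + 2) - d) <
    2 * boxCount d (2 * s) (s * (d - 1) - (k * (s + 1) + 2)) := by
  obtain ⟨r, rfl⟩ : ∃ r, s = r + 1 := ⟨s - 1, by omega⟩
  have hd1 : 1 ≤ d := by omega
  have hdZ : (d : ℤ) = k * (2 * r + 3) + 2 := by rw [hd]; push_cast; ring
  have hk0 : (0 : ℤ) ≤ k := by positivity
  have hr0 : (0 : ℤ) ≤ r := by positivity
  have hr3 : (3 : ℤ) ≤ r := by omega
  have hkr : (k : ℤ) * 3 ≤ k * r := mul_le_mul_of_nonneg_left hr3 hk0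
  have hkrr : (k : ℤ) * r * 3 ≤ k * r * r := mul_le_mul_of_nonneg_left hr3 (by positivity)
  set Z : ℤ := (r + 1 : ℕ) * (d - 1) with hZ
  set D : ℤ := k * ((r + 1 : ℕ) + 1) + 2 with hD
  have hZ' : Z = (r + 1) * (d - 1) := by rw [hZ]; push_cast; ring
  have hD' : D = k * (r + 2) + 2 := by rw [hD]; push_cast; ring
  have sym : ∀ j, boxCount d (2 * (r + 1)) (Z - j) = boxCount d (2 * (r + 1)) (Z + j) := by
    intro j
    rw [← boxCount_symm hd1 (2 * (r + 1)) (Z + j)]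
    congr 1
    rw [hZ']; push_cast; ring
  rw [sub_add, sub_sub, sym, sym, sym]
  set H : ℤ := Z + D - d with hH
  set v : ℤ → ℤ := boxCount d (2 * r + 1) with hv
  have left := boxCount_sub_eq_sum d (2 * r + 1) (Z - D) (k + 2)
  have right := boxCount_sub_eq_sum d (2 * r + 1) H d
  have e1 : Z + (D - d) = Z - (d - D) := by ring
  rw [e1, sym]
  rw [show Z - D + d + ((k + 2 : ℕ) : ℤ) = Z + D by push_cast; rw [hD', hdZ]; ring,
    show Z - D + (d : ℤ) = Z + (d - D) by ring] at left
  rw [show H + (d : ℤ) + d = Z + (D + d) by rw [hH]; ring,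
    show H + (d : ℤ) = Z + D by rw [hH]; ring] at right
  rw [show 2 * (r + 1) = 2 * r + 1 + 1 by ring] at *
  rw [← hv] at left right
  suffices h : ∑ i ∈ Finset.range (k + 2), (v (Z - D + 1 + i) - v (Z - D + 1 + i + d)) <
      ∑ i ∈ Finset.range d, (v (H + 1 + i) - v (H + 1 + i + d)) by linarith
  have hHval : H = Z - D + k + 2 := by rw [hH, hD', hdZ]; ring
  -- `H` lies `(k + 1) / 2` to the right of the centre of `v`, so `v` decreases beyond it.
  have hcen : 2 * H = (2 * r + 1 : ℕ) * (d - 1) + (k + 1) := by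
    rw [hH, hZ', hD', hdZ]; push_cast; ring
  have hHpos : 0 < v H := by
    refine boxCount_pos hd1 _ ?_ ?_
    · rw [hH, hZ', hD', hdZ]; linarith
    · rw [hH, hZ', hD', hdZ]; push_cast; linarith
  have hdrop : v (H + d) < v H := by
    refine boxCount_add_lt hd1 _ (by linarith) ?_
    rw [hH, hZ', hD', hdZ]; push_cast; linarith
  -- `T` is far enough out that `(r + 1) * k` terms of the right sum are at least `v T`, yet near
  -- enough that the `k + 2` left terms are at most `2 * v T`.
  set T : ℤ := H + (r + 1) * k with hT
  have hTpos : 0 < v T := by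
    refine boxCount_pos hd1 _ ?_ ?_
    · rw [hT, hH, hZ', hD', hdZ]; linarith
    · rw [hT, hH, hZ', hD', hdZ]; push_cast; linarith
  have lower : ∀ y ≤ H, v H * (v y - v (y + d)) ≤ v y * (v H - v (H + d)) := by
    intro y hy
    have := boxCount_mul_le d (2 * r + 1) (x := y) (t := H + d) (y := H) (z := y + d) hy
      (by omega) (by ring)
    rw [← hv] at this
    linarith
  have upper : ∀ y, H ≤ y → v y * (v H - v (H + d)) ≤ v H * (v y - v (y + d)) := by
    intro y hy
    have := boxCount_mul_le d (2 * r + 1) (x := H) (t := y + d) (y := y) (z := H + d) hy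
      (by omega) (by ring)
    rw [← hv] at this
    linarith
  have hL : ∑ i ∈ Finset.range (k + 2), v (Z - D + 1 + i) ≤ (k + 2) * (2 * v T) := by
    have : ∑ i ∈ Finset.range (k + 2), v (Z - D + 1 + i) ≤
        ∑ i ∈ Finset.range (k + 2), 2 * v T := by
      refine Finset.sum_le_sum fun i hi => ?_
      have hi' : (i : ℤ) ≤ k + 1 := by have := Finset.mem_range.1 hi; omega
      have hi0 : (0 : ℤ) ≤ i := by positivity
      have hdE : (d : ℤ) = 2 * (k * r) + 3 * k + 2 := by rw [hdZ]; ring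
      have hTE : T = H + k * r + k := by rw [hT]; ring
      refine boxCount_le_two_mul hd1 (2 * r) ?_ ?_ ?_
      · linarith
      · linarith
      · push_cast at hcen ⊢; linarith
    simpa using this
  have hR : (r + 1) * k * v T ≤ ∑ i ∈ Finset.range d, v (H + 1 + i) := by
    have h1 : ∑ i ∈ Finset.range ((r + 1) * k), v T ≤
        ∑ i ∈ Finset.range ((r + 1) * k), v (H + 1 + i) := by
      refine Finset.sum_le_sum fun i hi => ?_
      have : ((i : ℤ)) + 1 ≤ (r + 1) * k := by exact_mod_cast Finset.mem_range.1 hi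
      refine boxCount_le hd1 _ (by rw [hT]; linarith) ?_
      have : (0 : ℤ) ≤ (r + 1) * k := by positivity
      rw [hT]; linarith
    have h2 : ∑ i ∈ Finset.range ((r + 1) * k), v (H + 1 + i) ≤
        ∑ i ∈ Finset.range d, v (H + 1 + i) := by
      refine Finset.sum_le_sum_of_subset_of_nonneg (Finset.range_mono ?_)
        fun _ _ _ => boxCount_nonneg _ _ _
      rw [hd, mul_comm]
      exact (Nat.mul_le_mul_left k (by omega)).trans (Nat.le_add_right _ _)
    have h3 : ∑ i ∈ Finset.range ((r + 1) * k), v T = (r + 1) * k * v T := by simp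
    linarith
  refine lt_of_mul_lt_mul_left ?_ hHpos.le
  calc v H * ∑ i ∈ Finset.range (k + 2), (v (Z - D + 1 + i) - v (Z - D + 1 + i + d))
      ≤ (∑ i ∈ Finset.range (k + 2), v (Z - D + 1 + i)) * (v H - v (H + d)) := by
        rw [Finset.mul_sum, Finset.sum_mul]
        refine Finset.sum_le_sum fun i hi => lower _ ?_
        have := Finset.mem_range.1 hi
        omega
    _ < (∑ i ∈ Finset.range d, v (H + 1 + i)) * (v H - v (H + d)) := by
        refine mul_lt_mul_of_pos_right ?_ (by linarith)
        have h3 : (3 : ℤ) ≤ k := by exact_mod_cast hk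
        -- This is where `r ≥ 3` and `k ≥ 3` are needed: `2k + 4 < 4k ≤ (r + 1)k`.
        have h4 : ((k : ℤ) + 2) * 2 < (r + 1) * k := by linarith
        have h5 := mul_lt_mul_of_pos_right h4 hTpos
        linarith
    _ ≤ v H * ∑ i ∈ Finset.range d, (v (H + 1 + i) - v (H + 1 + i + d)) := by
        rw [Finset.mul_sum, Finset.sum_mul]
        exact Finset.sum_le_sum fun i _ => upper _ (by omega)

/-- Taking unit differences at `j` and at `j - d` removes one variable and leaves a second
difference of step `d` centred at `j - d`. -/
theorem boxCount_difference_lt {s k d : ℕ} (hs : 4 ≤ s) (hk : 3 ≤ k)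
    (hd : d = k * (2 * s + 1) + 2) {j : ℤ} (hj : j = s * (k * (2 * s + 2) + 1)) :
    boxCount d (2 * s + 1) j + boxCount d (2 * s + 1) (j - 1 - d) <
      boxCount d (2 * s + 1) (j - 1) + boxCount d (2 * s + 1) (j - d) := by
  have h := boxCount_second_difference hs hk hd
  have e : j = s * (d - 1) - (k * (s + 1) + 2) + (d : ℤ) := by
    rw [hj, hd]; push_cast; ring
  have h1 := boxCount_succ_sub d (2 * s) j
  have h2 := boxCount_succ_sub d (2 * s) (j - d)
  rw [show j - d - 1 = j - 1 - (d : ℤ) by ring] at h2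
  rw [← e, show (s * (d - 1) - (k * (s + 1) + 2) : ℤ) = j - d by rw [e]; ring] at h
  linarith

/-! ### Strong Lefschetz property of the monomial complete intersection -/

section Lefschetz

variable {σ K : Type*} [Field K]

/-- The ideal `(x_i ^ d : i ∈ σ)`. -/
noncomputable def varPowIdeal (σ K : Type*) [Field K] (d : ℕ) : Ideal (MvPolynomial σ K) :=
  Ideal.span (Set.range fun i : σ => (X i : MvPolynomial σ K) ^ d)

theorem mem_varPowIdeal_iff {d : ℕ} {f : MvPolynomial σ K} :
    f ∈ varPowIdeal σ K d ↔ ∀ m : σ →₀ ℕ, (∀ i, m i < d) → coeff m f = 0 := by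
  have e : (Set.range fun i : σ => (X i : MvPolynomial σ K) ^ d) =
      (fun s => monomial s (1 : K)) '' Set.range fun i : σ => Finsupp.single i d := by
    rw [← Set.range_comp]
    exact congrArg Set.range (funext fun i => X_pow_eq_monomial)
  rw [varPowIdeal, e, mem_ideal_span_monomial_image]
  refine forall_congr' fun m => ?_
  rw [mem_support_iff, ← not_imp_comm]
  simp

theorem coeff_X_mul_pderiv (i : σ) (m : σ →₀ ℕ) (f : MvPolynomial σ K) :
    coeff m (X i * pderiv i f) = m i * coeff m f := by
  classical
  induction f using MvPolynomial.induction_on' with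
  | monomial u c =>
    rw [X_mul_pderiv_monomial, coeff_smul, coeff_monomial]
    split_ifs with h
    · simp [h]
    · simp
  | add p q hp hq => rw [map_add, mul_add, coeff_add, hp, hq, coeff_add, mul_add]

variable [Fintype σ]

/-- The lowering operator of the `sl₂`-action on `K[x_i]/(x_i ^ d)` whose raising operator is
multiplication by `∑ a_i x_i`. -/
noncomputable def lowering (a : σ → K) (d : ℕ) : MvPolynomial σ K →ₗ[K] MvPolynomial σ K :=
  ∑ i, (a i)⁻¹ • (((d : K) - 1) • (pderiv i).toLinearMap -
    LinearMap.mulLeft K (X i) ∘ₗ (pderiv i).toLinearMap ∘ₗ (pderiv i).toLinearMap)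

theorem lowering_apply (a : σ → K) (d : ℕ) (f : MvPolynomial σ K) :
    lowering a d f = ∑ i, C (a i)⁻¹ * (C ((d : K) - 1) * pderiv i f -
      X i * pderiv i (pderiv i f)) := by
  simp [lowering, LinearMap.sum_apply, smul_eq_C_mul]

theorem coeff_lowering (a : σ → K) (d : ℕ) (m : σ →₀ ℕ) (f : MvPolynomial σ K) :
    coeff m (lowering a d f) = ∑ i, (a i)⁻¹ * (((m i : K) + 1) * ((d : K) - 1 - m i)) *
      coeff (m + Finsupp.single i 1) f := by
  rw [lowering_apply, coeff_sum]
  refine Finset.sum_congr rfl fun i _ => ?_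
  rw [coeff_C_mul, coeff_sub, coeff_C_mul, coeff_X_mul_pderiv, coeff_pderiv]
  ring

/-- The only contributions from outside the box come from exponents `m i = d - 1`, where the factor
`d - 1 - m i` vanishes. -/
theorem lowering_mem {d : ℕ} (a : σ → K) {f : MvPolynomial σ K} (hf : f ∈ varPowIdeal σ K d) :
    lowering a d f ∈ varPowIdeal σ K d := by
  classical
  rw [mem_varPowIdeal_iff] at *
  intro m hm
  rw [coeff_lowering]
  refine Finset.sum_eq_zero fun i _ => ?_
  by_cases h : m i + 1 = d
  · rw [← h]; push_cast; ring
  · rw [hf, mul_zero]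
    intro j
    have := hm j
    rw [Finsupp.add_apply, Finsupp.single_apply]
    split_ifs with hij
    · subst hij; omega
    · omega

theorem lowering_isHomogeneous {d e : ℕ} (a : σ → K) {f : MvPolynomial σ K}
    (hf : f.IsHomogeneous (e + 1)) : (lowering a d f).IsHomogeneous e := by
  intro m hm
  rw [coeff_lowering] at hm
  obtain ⟨i, -, hi⟩ := Finset.exists_ne_zero_of_sum_ne_zero hm
  have := hf (right_ne_zero_of_mul hi)
  rw [map_add, Finsupp.weight_single] at this
  simpa using this

/-- The linear form `∑ a_i x_i`. -/
noncomputable def linForm (a : σ → K) : MvPolynomial σ K := ∑ i, C (a i) * X i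

theorem linForm_isHomogeneous (a : σ → K) : (linForm a).IsHomogeneous 1 :=
  IsHomogeneous.sum _ _ _ fun i _ => isHomogeneous_C_mul_X (a i) i

theorem linForm_pow_isHomogeneous (a : σ → K) (k : ℕ) : (linForm a ^ k).IsHomogeneous k := by
  simpa using (linForm_isHomogeneous a).pow k

theorem pderiv_linForm (a : σ → K) (i : σ) : pderiv i (linForm a) = C (a i) := by
  classical
  simp [linForm, pderiv_X, Pi.single_apply]

/-- The `sl₂` relation: the commutator of lowering and raising acts on degree `e` by the weight,
computed with Euler's identity. -/
theorem lowering_linForm_mul {a : σ → K} (ha : ∀ i, a i ≠ 0) (d : ℕ) {e : ℕ}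
    {g : MvPolynomial σ K} (hg : g.IsHomogeneous e) :
    lowering a d (linForm a * g) = linForm a * lowering a d g +
      C (Fintype.card σ * ((d : K) - 1) - 2 * e) * g := by
  have euler : ∑ i, X i * pderiv i g = C (e : K) * g := by
    rw [hg.sum_X_mul_pderiv]; simp [nsmul_eq_mul]
  have : C (Fintype.card σ * ((d : K) - 1) - 2 * e) * g =
      ∑ i : σ, (C ((d : K) - 1) * g - 2 * (X i * pderiv i g)) := by
    rw [Finset.sum_sub_distrib, ← Finset.mul_sum, ← Finset.mul_sum, euler]
    simp only [map_sub, map_mul, map_natCast, map_ofNat, map_one, Finset.sum_const,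
      Finset.card_univ, nsmul_eq_mul]
    ring
  rw [this, lowering_apply, lowering_apply, Finset.mul_sum, ← Finset.sum_add_distrib]
  refine Finset.sum_congr rfl fun i _ => ?_
  have hai : (C (a i)⁻¹ * C (a i) : MvPolynomial σ K) = 1 := by
    rw [← C_mul, inv_mul_cancel₀ (ha i), C_1]
  simp only [pderiv_mul, pderiv_linForm, map_add, pderiv_C, zero_mul, zero_add]
  linear_combination (C ((d : K) - 1) * g - 2 * (X i * pderiv i g)) * hai

theorem lowering_linForm_pow_mul {a : σ → K} (ha : ∀ i, a i ≠ 0) (d : ℕ) {e : ℕ}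
    {g : MvPolynomial σ K} (hg : g.IsHomogeneous e) (k : ℕ) :
    lowering a d (linForm a ^ (k + 1) * g) = linForm a ^ (k + 1) * lowering a d g +
      C ((k + 1) * (Fintype.card σ * ((d : K) - 1) - 2 * e - k)) * (linForm a ^ k * g) := by
  induction k with
  | zero => simp [lowering_linForm_mul ha d hg]
  | succ k ih =>
    have hh : (linForm a ^ (k + 1) * g).IsHomogeneous (k + 1 + e) :=
      (linForm_pow_isHomogeneous a _).mul hg
    rw [pow_succ', mul_assoc, lowering_linForm_mul ha d hh, ih]
    simp only [map_add, map_sub, map_mul, Nat.cast_add, Nat.cast_one, C_1, map_ofNat]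
    ring

/-- The strong Lefschetz property of `K[x_i]/(x_i ^ d)` in characteristic zero. -/
theorem mem_varPowIdeal_of_linForm_pow_mul_mem [CharZero K] {a : σ → K} (ha : ∀ i, a i ≠ 0)
    {d : ℕ} (hd : 1 ≤ d) {e k : ℕ} {g : MvPolynomial σ K} (hg : g.IsHomogeneous e)
    (hek : 2 * e + k ≤ Fintype.card σ * (d - 1))
    (h : linForm a ^ k * g ∈ varPowIdeal σ K d) : g ∈ varPowIdeal σ K d := by
  have hN : ((Fintype.card σ * (d - 1) : ℕ) : K) = Fintype.card σ * ((d : K) - 1) := by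
    push_cast [hd]; ring
  -- For `g` of lowest weight modulo the ideal, lowering `L ^ (k + 1) * g` returns a nonzero
  -- multiple of `L ^ k * g`, so the power of `L` can be stripped off.
  have descend : ∀ {e k : ℕ} {g : MvPolynomial σ K}, g.IsHomogeneous e →
      2 * e + k ≤ Fintype.card σ * (d - 1) → lowering a d g ∈ varPowIdeal σ K d →
      linForm a ^ k * g ∈ varPowIdeal σ K d → g ∈ varPowIdeal σ K d := by
    intro e k g hg hek hD h
    induction k with
    | zero => simpa using h
    | succ k ih =>
      refine ih (by omega) ?_
      have h1 := lowering_mem a h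
      rw [lowering_linForm_pow_mul ha d hg] at h1
      have h2 := (Ideal.add_mem_iff_right _ (Ideal.mul_mem_left _ (linForm a ^ (k + 1)) hD)).1 h1
      have hc : ((k : K) + 1) * (Fintype.card σ * ((d : K) - 1) - 2 * e - k) ≠ 0 := by
        obtain ⟨r, hr⟩ := Nat.exists_eq_add_of_le hek
        rw [← hN, hr]
        have : ((2 * e + (k + 1) + r : ℕ) : K) - 2 * e - k = ((r + 1 : ℕ) : K) := by
          push_cast; ring
        rw [this]
        exact_mod_cast Nat.mul_ne_zero (Nat.succ_ne_zero k) (Nat.succ_ne_zero r)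
      have h3 := Ideal.mul_mem_left _ (C ((k + 1) * (Fintype.card σ * ((d : K) - 1) - 2 * e - k))⁻¹) h2
      rwa [← mul_assoc, ← C_mul, inv_mul_cancel₀ hc, C_1, one_mul] at h3
  induction e generalizing g k with
  | zero =>
    refine descend hg hek ?_ h
    rw [← totalDegree_zero_iff_isHomogeneous, totalDegree_eq_zero_iff_eq_C] at hg
    rw [hg, lowering_apply]
    simp
  | succ e ih =>
    -- `L ^ (k + 1) * lowering g` lies in the ideal, and one degree less with one more factor `L`
    -- keeps `2 * e + k` within the bound; so `g` is of lowest weight modulo the ideal.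
    refine descend hg hek (ih (k := k + 1) (lowering_isHomogeneous a hg) (by omega) ?_) h
    have h1 : linForm a ^ (k + 1) * g ∈ varPowIdeal σ K d := by
      rw [pow_succ', mul_assoc]; exact Ideal.mul_mem_left _ _ h
    have h2 := lowering_mem a h1
    rw [lowering_linForm_pow_mul ha d hg] at h2
    exact (Ideal.add_mem_iff_left _ (Ideal.mul_mem_left _ _ h)).1 h2

end Lefschetz

/-! ### Hilbert function of the almost complete intersection -/

section Truncation

variable {K : Type*} [Field K] {m : ℕ}

/-- The exponents of the monomials of degree `j` in `m` variables that are not divisible by any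
`x_i ^ d`. -/
noncomputable def boxExponents (d m j : ℕ) : Finset (Fin m →₀ ℕ) :=
  (Finset.finsuppAntidiag Finset.univ j).filter fun u => ∀ i, u i < d

theorem mem_boxExponents {d j : ℕ} {u : Fin m →₀ ℕ} :
    u ∈ boxExponents d m j ↔ u.degree = j ∧ ∀ i, u i < d := by
  simp [boxExponents, Finsupp.degree_eq_sum]

theorem card_boxExponents (d m j : ℕ) : ((boxExponents d m j).card : ℤ) = boxCount d m j := by
  rw [boxCount, ← Finset.sum_filter, Finset.sum_const, nsmul_one, Nat.cast_inj]
  refine Finset.card_bij' (fun u hu i => ⟨u i, (mem_boxExponents.1 hu).2 i⟩)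
    (fun f _ => Finsupp.equivFunOnFinite.symm fun i => (f i : ℕ)) ?_ ?_ ?_ ?_
  · intro u hu
    have := (mem_boxExponents.1 hu).1
    rw [Finsupp.degree_eq_sum] at this
    simp [← this]
  · intro f hf
    rw [Finset.mem_filter] at hf
    rw [mem_boxExponents, Finsupp.degree_eq_sum]
    refine ⟨?_, fun i => by simp⟩
    have := hf.2
    zify
    simpa using this
  · intro u hu
    ext i
    simp
  · intro f hf
    ext i
    simp

/-- The sum of the terms of degree `j` of a polynomial that are not divisible by any `x_i ^ d`. -/
noncomputable def truncation (K : Type*) [Field K] (d m j : ℕ) :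
    MvPolynomial (Fin m) K →ₗ[K] MvPolynomial (Fin m) K :=
  ∑ u ∈ boxExponents d m j, monomial u ∘ₗ lcoeff K u

theorem coeff_truncation (d j : ℕ) (f : MvPolynomial (Fin m) K) (u : Fin m →₀ ℕ) :
    coeff u (truncation K d m j f) = if u ∈ boxExponents d m j then coeff u f else 0 := by
  classical
  simp [truncation, LinearMap.sum_apply, coeff_sum, coeff_monomial]

theorem truncation_eq_zero {d j : ℕ} {f : MvPolynomial (Fin m) K}
    (hf : f ∈ varPowIdeal (Fin m) K d) : truncation K d m j f = 0 := by
  ext u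
  rw [coeff_truncation, coeff_zero]
  split_ifs with h
  · exact mem_varPowIdeal_iff.1 hf u (mem_boxExponents.1 h).2
  · rfl

theorem sub_truncation_mem {d j : ℕ} {f : MvPolynomial (Fin m) K} (hf : f.IsHomogeneous j) :
    f - truncation K d m j f ∈ varPowIdeal (Fin m) K d := by
  rw [mem_varPowIdeal_iff]
  intro u hu
  rw [coeff_sub, coeff_truncation]
  split_ifs with h
  · exact sub_self _
  · rw [sub_zero]
    exact hf.coeff_eq_zero fun h' => h (mem_boxExponents.2 ⟨h', hu⟩)

/-- The span of the monomials of degree `j` that are not divisible by any `x_i ^ d`. -/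
noncomputable abbrev boxSpan (K : Type*) [Field K] (d m j : ℕ) :
    Submodule K (MvPolynomial (Fin m) K) :=
  restrictSupport K (boxExponents d m j : Set (Fin m →₀ ℕ))

theorem finrank_boxSpan (d m j : ℕ) :
    Module.finrank K (boxSpan K d m j) = (boxExponents d m j).card := by
  rw [Module.finrank_eq_card_basis (basisRestrictSupport K _)]
  simp

instance (d m j : ℕ) : FiniteDimensional K (boxSpan K d m j) :=
  Module.Basis.finiteDimensional_of_finite (basisRestrictSupport K _)

theorem mem_boxSpan_iff {d j : ℕ} {f : MvPolynomial (Fin m) K} :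
    f ∈ boxSpan K d m j ↔ ∀ u ∉ boxExponents d m j, coeff u f = 0 := by
  rw [mem_restrictSupport_iff]
  refine ⟨fun h u hu => ?_, fun h u hu => ?_⟩
  · by_contra h'
    exact hu (h (mem_support_iff.2 h'))
  · by_contra h'
    exact mem_support_iff.1 hu (h u h')

theorem truncation_mem (d j : ℕ) (f : MvPolynomial (Fin m) K) :
    truncation K d m j f ∈ boxSpan K d m j :=
  mem_boxSpan_iff.2 fun u hu => by rw [coeff_truncation, if_neg hu]

theorem truncation_of_mem {d j : ℕ} {f : MvPolynomial (Fin m) K} (hf : f ∈ boxSpan K d m j) :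
    truncation K d m j f = f := by
  ext u
  rw [coeff_truncation]
  split_ifs with h
  · rfl
  · exact (mem_boxSpan_iff.1 hf u h).symm

theorem isHomogeneous_of_mem_boxSpan {d j : ℕ} {f : MvPolynomial (Fin m) K}
    (hf : f ∈ boxSpan K d m j) : f.IsHomogeneous j := by
  intro u hu
  by_contra h
  refine hu (mem_boxSpan_iff.1 hf u fun h' => h ?_)
  rw [← (mem_boxExponents.1 h').1]
  exact (Finsupp.degree_eq_weight_one (R := ℕ) ▸ rfl)

theorem eq_zero_of_mem_boxSpan {d j : ℕ} {f : MvPolynomial (Fin m) K}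
    (hf : f ∈ boxSpan K d m j) (h : f ∈ varPowIdeal (Fin m) K d) : f = 0 := by
  rw [← truncation_of_mem hf, truncation_eq_zero h]

theorem truncation_mul {d e k : ℕ} (g : MvPolynomial (Fin m) K) {h : MvPolynomial (Fin m) K}
    (hh : h.IsHomogeneous k) :
    truncation K d m (e + k) (g * h) = truncation K d m (e + k) (truncation K d m e g * h) := by
  have h1 : truncation K d m (e + k) (g * h) =
      truncation K d m (e + k) (homogeneousComponent e g * h) := by
    ext u
    rw [coeff_truncation, coeff_truncation]
    split_ifs with hu
    · rw [coeff_mul, coeff_mul]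
      refine Finset.sum_congr rfl fun p hp => ?_
      rw [coeff_homogeneousComponent]
      split_ifs with hd
      · rfl
      · by_cases hq : coeff p.2 h = 0
        · rw [hq, mul_zero, mul_zero]
        · exfalso
          have h2 : p.2.degree = k := by
            by_contra h2
            exact hq (hh.coeff_eq_zero h2)
          have h3 := (mem_boxExponents.1 hu).1
          rw [← Finset.HasAntidiagonal.mem_antidiagonal.1 hp, map_add] at h3
          omega
    · rfl
  have h2 : truncation K d m e (homogeneousComponent e g) = truncation K d m e g := by
    ext u
    rw [coeff_truncation, coeff_truncation]
    split_ifs with hu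
    · rw [coeff_homogeneousComponent, if_pos (mem_boxExponents.1 hu).1]
    · rfl
  rw [h1, ← sub_eq_zero, ← map_sub, ← sub_mul, ← h2]
  exact truncation_eq_zero (Ideal.mul_mem_right _ _
    (sub_truncation_mem (homogeneousComponent_isHomogeneous e g)))

/-- Multiplication by `L ^ k` on `K[x_i]/(x_i ^ d)`, from degree `e` to degree `e + k`. -/
noncomputable def mulPowBox (a : Fin m → K) (d e k : ℕ) :
    boxSpan K d m e →ₗ[K] boxSpan K d m (e + k) :=
  LinearMap.codRestrict _ ((truncation K d m (e + k) ∘ₗ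
    LinearMap.mulRight K (linForm a ^ k)) ∘ₗ (boxSpan K d m e).subtype) fun _ => truncation_mem _ _ _

theorem mulPowBox_apply (a : Fin m → K) (d e k : ℕ) (g : boxSpan K d m e) :
    (mulPowBox a d e k g : MvPolynomial (Fin m) K) =
      truncation K d m (e + k) (g * linForm a ^ k) := rfl

theorem mulPowBox_injective [CharZero K] {a : Fin m → K} (ha : ∀ i, a i ≠ 0) {d e k : ℕ}
    (hd : 1 ≤ d) (hek : 2 * e + k ≤ m * (d - 1)) : Function.Injective (mulPowBox a d e k) := by
  rw [injective_iff_map_eq_zero]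
  intro g hg
  have hhom := isHomogeneous_of_mem_boxSpan g.2
  have h1 := sub_truncation_mem (d := d) (hhom.mul (linForm_pow_isHomogeneous a k))
  rw [← mulPowBox_apply, hg, ZeroMemClass.coe_zero, sub_zero, mul_comm] at h1
  exact Subtype.ext (eq_zero_of_mem_boxSpan g.2
    (mem_varPowIdeal_of_linForm_pow_mul_mem ha hd hhom (by simpa using hek) h1))

/-- The ideal `(x_i ^ d, L ^ d)`. -/
noncomputable def almostCIIdeal (a : Fin m → K) (d : ℕ) : Ideal (MvPolynomial (Fin m) K) :=
  Ideal.span (Set.range (fun i : Fin m => (X i : MvPolynomial (Fin m) K) ^ d) ∪ {linForm a ^ d})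

theorem almostCIIdeal_eq (a : Fin m → K) (d : ℕ) :
    almostCIIdeal a d = varPowIdeal (Fin m) K d ⊔ Ideal.span {linForm a ^ d} := by
  rw [almostCIIdeal, Ideal.span_union, varPowIdeal]

theorem varPowIdeal_le (a : Fin m → K) (d : ℕ) : varPowIdeal (Fin m) K d ≤ almostCIIdeal a d := by
  rw [almostCIIdeal_eq]; exact le_sup_left

/-- The projection of the truncated forms of degree `j` to `R/(x_i ^ d, L ^ d)`. -/
noncomputable def boxToQuotient (a : Fin m → K) (d j : ℕ) :
    boxSpan K d m j →ₗ[K] MvPolynomial (Fin m) K ⧸ almostCIIdeal a d :=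
  (Ideal.Quotient.mkₐ K (almostCIIdeal a d)).toLinearMap ∘ₗ (boxSpan K d m j).subtype

theorem range_boxToQuotient (a : Fin m → K) (d j : ℕ) :
    LinearMap.range (boxToQuotient a d j) = quotientComponent (almostCIIdeal a d) j := by
  apply le_antisymm
  · rintro _ ⟨f, rfl⟩
    exact ⟨f, isHomogeneous_of_mem_boxSpan f.2, rfl⟩
  · rintro _ ⟨f, hf, rfl⟩
    refine ⟨⟨_, truncation_mem d j f⟩, ?_⟩
    refine (Ideal.Quotient.eq.2 (varPowIdeal_le a d ?_)).symm
    exact sub_truncation_mem hf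

/-- Modulo the `x_i ^ d`, a degree `e + d` element of the ideal is a multiple of `L ^ d`, whose
cofactor can be truncated to degree `e`. -/
theorem ker_boxToQuotient (a : Fin m → K) (d e : ℕ) :
    LinearMap.ker (boxToQuotient a d (e + d)) = LinearMap.range (mulPowBox a d e d) := by
  ext f
  rw [LinearMap.mem_ker]
  change Ideal.Quotient.mk _ (f : MvPolynomial (Fin m) K) = 0 ↔ _
  rw [Ideal.Quotient.eq_zero_iff_mem]
  constructor
  · intro hf
    rw [almostCIIdeal_eq] at hf
    obtain ⟨u, hu, w, hw, huw⟩ := Submodule.mem_sup.1 hf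
    obtain ⟨g, rfl⟩ := Ideal.mem_span_singleton'.1 hw
    refine ⟨⟨_, truncation_mem d e g⟩, Subtype.ext ?_⟩
    rw [mulPowBox_apply, ← truncation_mul g (linForm_pow_isHomogeneous a d),
      ← truncation_of_mem f.2, ← huw, map_add, truncation_eq_zero hu, zero_add]
  · rintro ⟨g, rfl⟩
    rw [mulPowBox_apply]
    have h1 := varPowIdeal_le a d (sub_truncation_mem (d := d)
      ((isHomogeneous_of_mem_boxSpan g.2).mul (linForm_pow_isHomogeneous a d)))
    have h2 : (g : MvPolynomial (Fin m) K) * linForm a ^ d ∈ almostCIIdeal a d :=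
      Ideal.mul_mem_left _ _ (Ideal.subset_span (Or.inr rfl))
    simpa using Ideal.sub_mem _ h2 h1

theorem finrank_quotientComponent (a : Fin m → K) (d e : ℕ) :
    Module.finrank K (quotientComponent (almostCIIdeal a d) (e + d)) +
      Module.finrank K (LinearMap.range (mulPowBox a d e d)) = (boxExponents d m (e + d)).card := by
  rw [← range_boxToQuotient, ← ker_boxToQuotient, LinearMap.finrank_range_add_finrank_ker,
    finrank_boxSpan]

/-- The image of multiplication by `L ^ d` is no larger than its source; no Lefschetz property is
needed for this bound. -/
theorem le_finrank_quotientComponent (a : Fin m → K) (d e : ℕ) :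
    (boxExponents d m (e + d)).card ≤
      Module.finrank K (quotientComponent (almostCIIdeal a d) (e + d)) +
        (boxExponents d m e).card := by
  rw [← finrank_quotientComponent a d e, ← finrank_boxSpan (K := K) d m e]
  exact Nat.add_le_add_left (LinearMap.finrank_range_le _) _

theorem finrank_quotientComponent_of_le [CharZero K] {a : Fin m → K} (ha : ∀ i, a i ≠ 0)
    {d e : ℕ} (hd : 1 ≤ d) (hek : 2 * e + d ≤ m * (d - 1)) :
    Module.finrank K (quotientComponent (almostCIIdeal a d) (e + d)) + (boxExponents d m e).card =
      (boxExponents d m (e + d)).card := by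
  rw [← finrank_quotientComponent a d e, ← finrank_boxSpan (K := K) d m e,
    LinearMap.finrank_range_of_inj (mulPowBox_injective ha hd hek)]

instance (a : Fin m → K) (d j : ℕ) :
    FiniteDimensional K (quotientComponent (almostCIIdeal a d) j) := by
  rw [← range_boxToQuotient]; infer_instance

theorem mul_mem_quotientComponent {I : Ideal (MvPolynomial (Fin m) K)} {i j : ℕ}
    {x y : MvPolynomial (Fin m) K ⧸ I} (hx : x ∈ quotientComponent I i)
    (hy : y ∈ quotientComponent I j) : x * y ∈ quotientComponent I (i + j) := by
  obtain ⟨f, hf, rfl⟩ := hx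
  obtain ⟨g, hg, rfl⟩ := hy
  exact ⟨f * g, IsHomogeneous.mul hf hg, map_mul (Ideal.Quotient.mk I) f g⟩

/-- Multiplication by a linear form is not injective where the Hilbert function drops. -/
theorem not_injective_of_card_lt [CharZero K] {a : Fin m → K} (ha : ∀ i, a i ≠ 0) {d e : ℕ}
    (hd : 1 ≤ d) (hek : 2 * (e + 1) + d ≤ m * (d - 1))
    (hlt : (boxExponents d m (e + 1 + d)).card + (boxExponents d m e).card <
      (boxExponents d m (e + d)).card + (boxExponents d m (e + 1)).card)
    {ℓ : MvPolynomial (Fin m) K ⧸ almostCIIdeal a d}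
    (hℓ : ℓ ∈ quotientComponent (almostCIIdeal a d) 1) :
    ¬ ∀ x ∈ quotientComponent (almostCIIdeal a d) (e + d), ℓ * x = 0 → x = 0 := by
  intro hinj
  have h1 := le_finrank_quotientComponent a d e
  have h2 := finrank_quotientComponent_of_le ha hd hek
  let f : quotientComponent (almostCIIdeal a d) (e + d) →ₗ[K]
      quotientComponent (almostCIIdeal a d) (e + 1 + d) :=
    (LinearMap.mulLeft K ℓ).restrict fun x hx => by
      have := mul_mem_quotientComponent hℓ hx
      rwa [show 1 + (e + d) = e + 1 + d by ring] at this
  have hf : Function.Injective f := by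
    rw [injective_iff_map_eq_zero]
    intro x hx
    exact Subtype.ext (hinj x x.2 (congrArg Subtype.val hx))
  have h3 := LinearMap.finrank_le_finrank_of_injective hf
  omega

end Truncation

/-! ### Multilinear forms killed by two derivations -/

section MultilinearInvariant

open scoped Polynomial in
-- By Lagrange interpolation the sum is the coefficient of `P` in degree `s.card - 1`.
theorem sum_eval_div_prod_sub_eq_zero {σ F : Type*} [Field F] [DecidableEq σ] {s : Finset σ}
    {p : σ → F} (hp : Set.InjOn p s) {P : F[X]} (hP : P.natDegree + 1 < s.card) :
    ∑ i ∈ s, P.eval (p i) / ∏ j ∈ s.erase i, (p i - p j) = 0 := by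
  rw [← Lagrange.coeff_eq_sum hp (lt_of_le_of_lt Polynomial.degree_le_natDegree (by exact_mod_cast (by omega)))]
  exact Polynomial.coeff_eq_zero_of_natDegree_lt (by omega)

/-- The linear conditions on the coefficients `f T` of a multilinear form of degree `r + 1` in the
variables of `S` which say that it is annihilated by `∑ ∂_i` and by `∑ p_i ∂_i`. -/
def IsInvariantFamily {σ R : Type*} [CommRing R] [DecidableEq σ] (S : Finset σ) (r : ℕ)
    (p : σ → R) (f : Finset σ → R) : Prop :=
  ∀ U ∈ S.powersetCard r, ∑ j ∈ S \ U, f (insert j U) = 0 ∧ ∑ j ∈ S \ U, p j * f (insert j U) = 0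

variable {σ : Type*} [DecidableEq σ]

open scoped Polynomial in
-- Up to a factor depending only on `U`, the coefficient at `insert j U` is `∏ (p u - p j)` over `u
-- ∈ U`, divided by `∏ (p j - p i)` over the remaining `i`. The conditions become the previous
-- identity on `r + 3` points for polynomials of degree at most `r + 1`.
theorem isInvariantFamily_of_injOn {F : Type*} [Field F] {S : Finset σ} {r : ℕ}
    (hS : S.card = 2 * r + 3) {p : σ → F} (hp : Set.InjOn p S) :
    IsInvariantFamily S r p fun T => ∏ j ∈ T, ∏ i ∈ S \ T, (p j - p i)⁻¹ := by
  intro U hU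
  obtain ⟨hUS, hUr⟩ := Finset.mem_powersetCard.1 hU
  have hcard : (S \ U).card = r + 3 := by rw [Finset.card_sdiff_of_subset hUS]; omega
  have key : ∀ q : F[X], q.natDegree ≤ 1 → ∑ j ∈ S \ U, q.eval (p j) *
      ∏ l ∈ insert j U, ∏ i ∈ S \ insert j U, (p l - p i)⁻¹ = 0 := by
    intro q hq
    set P : F[X] := q * ∏ u ∈ U, (Polynomial.C (p u) - Polynomial.X) with hPdef
    have hPdeg : P.natDegree ≤ r + 1 := by
      refine Polynomial.natDegree_mul_le.trans ?_
      have : (∏ u ∈ U, (Polynomial.C (p u) - Polynomial.X)).natDegree ≤ r := by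
        refine (Polynomial.natDegree_prod_le _ _).trans ?_
        refine (Finset.sum_le_card_nsmul _ _ 1 fun u _ => ?_).trans (by simp [hUr])
        exact (Polynomial.natDegree_sub_le _ _).trans (by simp)
      omega
    have h0 := sum_eval_div_prod_sub_eq_zero (s := S \ U) (p := p)
      (hp.mono (by simp)) (P := P) (by omega)
    have h1 : ∀ j ∈ S \ U, q.eval (p j) *
        ∏ l ∈ insert j U, ∏ i ∈ S \ insert j U, (p l - p i)⁻¹ =
        (∏ u ∈ U, ∏ i ∈ S \ U, (p u - p i)⁻¹) *
          (P.eval (p j) / ∏ i ∈ (S \ U).erase j, (p j - p i)) := by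
      intro j hj
      have hjU := (Finset.mem_sdiff.1 hj).2
      have hjS := (Finset.mem_sdiff.1 hj).1
      have e : S \ insert j U = (S \ U).erase j := by
        ext x; simp only [Finset.mem_sdiff, Finset.mem_insert, Finset.mem_erase]; tauto
      rw [Finset.prod_insert hjU, e, hPdef, Polynomial.eval_mul, Polynomial.eval_prod]
      have h2 : ∏ u ∈ U, ∏ i ∈ S \ U, (p u - p i)⁻¹ =
          (∏ u ∈ U, (p u - p j)⁻¹) * ∏ u ∈ U, ∏ i ∈ (S \ U).erase j, (p u - p i)⁻¹ := by
        rw [← Finset.prod_mul_distrib]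
        exact Finset.prod_congr rfl fun u _ => (Finset.mul_prod_erase _ _ hj).symm
      have h3 : (∏ u ∈ U, (p u - p j)⁻¹) * ∏ u ∈ U, (p u - p j) = 1 := by
        rw [← Finset.prod_mul_distrib]
        refine Finset.prod_eq_one fun u hu => inv_mul_cancel₀ (sub_ne_zero.2 fun h => ?_)
        exact hjU (hp (hUS hu) hjS h ▸ hu)
      simp only [Polynomial.eval_sub, Polynomial.eval_C, Polynomial.eval_X]
      rw [h2, Finset.prod_inv_distrib, div_eq_mul_inv]
      linear_combination (-(q.eval (p j)) * (∏ i ∈ (S \ U).erase j, (p j - p i))⁻¹ *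
        (∏ u ∈ U, ∏ i ∈ (S \ U).erase j, (p u - p i)⁻¹)) * h3
    rw [Finset.sum_congr rfl h1, ← Finset.mul_sum, h0, mul_zero]
  refine ⟨?_, ?_⟩
  · simpa using key 1 (by simp)
  · simpa using key Polynomial.X Polynomial.natDegree_X_le

open scoped Polynomial in
-- Nonzero solutions survive setting the parameter to zero: while all relevant coefficients vanish
-- there, a common factor `X` can be divided out, which lowers the degree of `g T`.
theorem IsInvariantFamily.exists_specialization {K : Type*} [Field K] {S : Finset σ} {r : ℕ}
    {p : σ → K[X]} (N : ℕ) {g : Finset σ → K[X]} (hg : IsInvariantFamily S r p g) {T : Finset σ}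
    (hT : T ∈ S.powersetCard (r + 1)) (hgT : g T ≠ 0) (hN : (g T).natDegree ≤ N) :
    ∃ f : Finset σ → K, IsInvariantFamily S r (fun i => (p i).eval 0) f ∧
      ∃ T ∈ S.powersetCard (r + 1), f T ≠ 0 := by
  induction N generalizing g with
  | zero =>
    refine ⟨fun T => (g T).eval 0, fun U hU => ?_, T, hT, ?_⟩
    · obtain ⟨h1, h2⟩ := hg U hU
      have h1 := congrArg (Polynomial.eval 0) h1
      have h2 := congrArg (Polynomial.eval 0) h2
      simp only [Polynomial.eval_finsetSum, Polynomial.eval_mul, Polynomial.eval_zero] at h1 h2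
      exact ⟨h1, h2⟩
    · intro h
      refine hgT ?_
      rw [Polynomial.eq_C_of_natDegree_le_zero hN, Polynomial.coeff_zero_eq_eval_zero]
      simpa using h
  | succ N ih =>
    by_cases h0 : ∃ T' ∈ S.powersetCard (r + 1), (g T').eval 0 ≠ 0
    · refine ⟨fun T => (g T).eval 0, fun U hU => ?_, h0⟩
      obtain ⟨h1, h2⟩ := hg U hU
      have h1 := congrArg (Polynomial.eval 0) h1
      have h2 := congrArg (Polynomial.eval 0) h2
      simp only [Polynomial.eval_finsetSum, Polynomial.eval_mul, Polynomial.eval_zero] at h1 h2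
      exact ⟨h1, h2⟩
    · push Not at h0
      have hdiv : ∀ T' ∈ S.powersetCard (r + 1), g T' = Polynomial.X * (g T').divX := by
        intro T' hT'
        have h1 := Polynomial.divX_mul_X_add (g T')
        rw [Polynomial.coeff_zero_eq_eval_zero, h0 T' hT', Polynomial.C_0, add_zero] at h1
        rw [mul_comm, h1]
      refine ih (g := fun T => (g T).divX) (fun U hU => ?_) (fun h => hgT ?_) ?_
      · have hins : ∀ j ∈ S \ U, insert j U ∈ S.powersetCard (r + 1) := by
          intro j hj
          obtain ⟨hUS, hUr⟩ := Finset.mem_powersetCard.1 hU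
          obtain ⟨hjS, hjU⟩ := Finset.mem_sdiff.1 hj
          rw [Finset.mem_powersetCard, Finset.card_insert_of_notMem hjU, hUr]
          exact ⟨Finset.insert_subset hjS hUS, rfl⟩
        obtain ⟨h1, h2⟩ := hg U hU
        rw [Finset.sum_congr rfl fun j hj => hdiv _ (hins j hj), ← Finset.mul_sum] at h1
        rw [Finset.sum_congr rfl fun j hj => by
          rw [hdiv _ (hins j hj), mul_left_comm], ← Finset.mul_sum] at h2
        exact ⟨(mul_eq_zero.1 h1).resolve_left Polynomial.X_ne_zero, (mul_eq_zero.1 h2).resolve_left Polynomial.X_ne_zero⟩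
      · rw [hdiv T hT, h, mul_zero]
      · rw [Polynomial.natDegree_divX_eq_natDegree_tsub_one]; omega

open scoped Polynomial in
-- Coinciding `p i` are separated by a perturbation `p i + q i * X` with distinct `q i`; the
-- explicit solution over the fraction field is cleared of denominators and specialised at zero.
theorem exists_isInvariantFamily {K : Type*} [Field K] [Infinite K] {S : Finset σ} {r : ℕ}
    (hS : S.card = 2 * r + 3) (p : σ → K) :
    ∃ f : Finset σ → K, IsInvariantFamily S r p f ∧ ∃ T ∈ S.powersetCard (r + 1), f T ≠ 0 := by
  obtain ⟨e⟩ : Nonempty (S ↪ K) := ⟨(S.equivFin.toEmbedding.trans Fin.valEmbedding).trans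
    (Infinite.natEmbedding K)⟩
  let q : σ → K := fun i => if h : i ∈ S then e ⟨i, h⟩ else 0
  let P : σ → K[X] := fun i => Polynomial.C (p i) + Polynomial.C (q i) * Polynomial.X
  have hP : Set.InjOn (fun i => algebraMap K[X] (FractionRing K[X]) (P i)) S := by
    intro i hi j hj hij
    have h1 := congrArg (fun Q => Polynomial.coeff Q 1) (IsFractionRing.injective K[X] (FractionRing K[X]) hij)
    have hi' : i ∈ S := hi
    have hj' : j ∈ S := hj
    simpa [P, q, hi', hj', Polynomial.coeff_C] using h1
  obtain ⟨b, hb⟩ := IsLocalization.exist_integer_multiples (nonZeroDivisors K[X])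
    S.powerset (fun T => ∏ j ∈ T, ∏ i ∈ S \ T,
      (algebraMap K[X] (FractionRing K[X]) (P j) - algebraMap K[X] (FractionRing K[X]) (P i))⁻¹)
  choose! g hg using hb
  have hb0 : algebraMap K[X] (FractionRing K[X]) b ≠ 0 := by simp
  obtain ⟨T, hTS, hTr⟩ := Finset.exists_subset_card_eq (show r + 1 ≤ S.card by omega)
  have hinv := isInvariantFamily_of_injOn hS hP
  have hsol : IsInvariantFamily S r P g := by
    intro U hU
    have hins : ∀ j ∈ S \ U, insert j U ∈ S.powerset := by
      intro j hj
      exact Finset.mem_powerset.2 (Finset.insert_subset (Finset.mem_sdiff.1 hj).1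
        (Finset.mem_powersetCard.1 hU).1)
    obtain ⟨h1, h2⟩ := hinv U hU
    constructor <;> apply IsFractionRing.injective K[X] (FractionRing K[X])
    · rw [map_sum, map_zero, Finset.sum_congr rfl fun j hj => hg _ (hins j hj), ← Finset.smul_sum,
        h1, smul_zero]
    · rw [map_sum, map_zero, Finset.sum_congr rfl fun j hj => by
        rw [map_mul, hg _ (hins j hj), mul_smul_comm], ← Finset.smul_sum, h2, smul_zero]
  have hgT : g T ≠ 0 := by
    intro h
    have h1 := hg T (Finset.mem_powerset.2 hTS)
    rw [h, map_zero, Algebra.smul_def] at h1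
    rcases mul_eq_zero.1 h1.symm with h2 | h2
    · exact hb0 h2
    · obtain ⟨j, hj, h3⟩ := Finset.prod_eq_zero_iff.1 h2
      obtain ⟨i, hi, h4⟩ := Finset.prod_eq_zero_iff.1 h3
      obtain ⟨hiS, hiT⟩ := Finset.mem_sdiff.1 hi
      exact hiT (hP (hTS hj) hiS (sub_eq_zero.1 (inv_eq_zero.1 h4)) ▸ hj)
  have := hsol.exists_specialization _ (Finset.mem_powersetCard.2 ⟨hTS, hTr⟩) hgT le_rfl
  simpa [P] using this

end MultilinearInvariant

/-! ### Construction of the dual form -/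

section DualForm

variable {σ K : Type*} [Field K]

/-- The multilinear form with the given coefficients. -/
noncomputable def multilinearForm (S : Finset σ) (r : ℕ) (f : Finset σ → K) : MvPolynomial σ K :=
  ∑ T ∈ S.powersetCard (r + 1), C (f T) * ∏ j ∈ T, X j

theorem multilinearForm_isHomogeneous (S : Finset σ) (r : ℕ) (f : Finset σ → K) :
    (multilinearForm S r f).IsHomogeneous (r + 1) := by
  refine IsHomogeneous.sum _ _ _ fun T hT => IsHomogeneous.C_mul ?_ _
  have := IsHomogeneous.prod T (fun j => (X j : MvPolynomial σ K)) (fun _ => 1)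
    fun j _ => isHomogeneous_X K j
  simpa [(Finset.mem_powersetCard.1 hT).2] using this

section

variable [Fintype σ]

/-- The derivation `∑ w_i ∂_i`. -/
noncomputable def directional (w : σ → K) : Derivation K (MvPolynomial σ K) (MvPolynomial σ K) :=
  ∑ i, w i • pderiv i

theorem directional_apply (w : σ → K) (f : MvPolynomial σ K) :
    directional w f = ∑ i, C (w i) * pderiv i f := by
  rw [directional, ← Derivation.coeFnAddMonoidHom_apply, map_sum, Finset.sum_apply]
  simp [smul_eq_C_mul]

end

variable [DecidableEq σ]

theorem pderiv_prod_X (i : σ) (T : Finset σ) :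
    pderiv i (∏ j ∈ T, X j : MvPolynomial σ K) = if i ∈ T then ∏ j ∈ T.erase i, X j else 0 := by
  have h0 : ∀ U : Finset σ, i ∉ U → pderiv i (∏ j ∈ U, X j : MvPolynomial σ K) = 0 := by
    intro U hU
    refine Finset.prod_induction _ (fun q => pderiv i q = 0) (fun a b ha hb => ?_) pderiv_one
      fun j hj => pderiv_X_of_ne fun h => hU (h ▸ hj)
    rw [pderiv_mul, ha, hb, zero_mul, mul_zero, add_zero]
  split_ifs with h
  · rw [← Finset.mul_prod_erase _ _ h, pderiv_mul, pderiv_X_self,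
      h0 _ (Finset.notMem_erase i T), one_mul, mul_zero, add_zero]
  · exact h0 T h

theorem coeff_prod_X (T : Finset σ) (u : σ →₀ ℕ) :
    coeff u (∏ j ∈ T, X j : MvPolynomial σ K) =
      if Finsupp.indicator T (fun _ _ => 1) = u then 1 else 0 := by
  have : (∏ j ∈ T, X j : MvPolynomial σ K) = monomial (Finsupp.indicator T fun _ _ => 1) 1 := by
    rw [Finsupp.indicator_eq_sum_single T fun _ => 1, monomial_sum_one]
    rfl
  rw [this, coeff_monomial]

theorem multilinearForm_ne_zero {S : Finset σ} {r : ℕ} {f : Finset σ → K} {T : Finset σ}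
    (hT : T ∈ S.powersetCard (r + 1)) (hf : f T ≠ 0) : multilinearForm S r f ≠ 0 := by
  intro h
  apply hf
  have h1 := congrArg (coeff (Finsupp.indicator T fun _ _ => 1)) h
  rw [multilinearForm, coeff_sum, coeff_zero, Finset.sum_eq_single T] at h1
  · simpa [coeff_C_mul, coeff_prod_X] using h1
  · intro T' _ hT'
    rw [coeff_C_mul, coeff_prod_X, if_neg, mul_zero]
    intro h2
    refine hT' (Finset.ext fun i => ?_)
    have h3 := DFunLike.congr_fun h2 i
    by_cases h4 : i ∈ T <;> by_cases h5 : i ∈ T' <;> simp [h4, h5] at h3 ⊢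
  · exact fun h' => absurd hT h'

theorem degreeOf_multilinearForm_le (S : Finset σ) (r : ℕ) (f : Finset σ → K) (i : σ) :
    degreeOf i (multilinearForm S r f) ≤ if i ∈ S then 1 else 0 := by
  refine (degreeOf_sum_le _ _ _).trans (Finset.sup_le fun T hT => ?_)
  refine (degreeOf_C_mul_le _ _ _).trans ((degreeOf_prod_le _ _ _).trans ?_)
  simp only [degreeOf_X, Finset.sum_ite_eq]
  have := (Finset.mem_powersetCard.1 hT).1
  split_ifs with h1 h2 <;> first | exact absurd (this h1) h2 | norm_num

variable [Fintype σ]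

/-- The coefficient of `∏ X j` over `j ∈ U` in the derivative collects the sets `T = insert i U`. -/
theorem directional_multilinearForm {S : Finset σ} {r : ℕ} {f : Finset σ → K} {w : σ → K}
    (h : ∀ U ∈ S.powersetCard r, ∑ j ∈ S \ U, w j * f (insert j U) = 0) :
    directional w (multilinearForm S r f) = 0 := by
  have h1 : directional w (multilinearForm S r f) = ∑ T ∈ S.powersetCard (r + 1), ∑ i ∈ T,
      C (w i * f T) * ∏ j ∈ T.erase i, X j := by
    rw [multilinearForm, map_sum]
    refine Finset.sum_congr rfl fun T _ => ?_
    rw [directional_apply]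
    simp only [pderiv_C_mul, pderiv_prod_X, mul_ite, mul_zero, Finset.sum_ite_mem,
      Finset.univ_inter, C_mul, mul_assoc]
  have h2 : ∑ T ∈ S.powersetCard (r + 1), ∑ i ∈ T, C (w i * f T) * ∏ j ∈ T.erase i, X j =
      ∑ U ∈ S.powersetCard r, ∑ i ∈ S \ U,
        (C (w i * f (insert i U)) * ∏ j ∈ U, X j : MvPolynomial σ K) := by
    rw [Finset.sum_sigma', Finset.sum_sigma']
    refine Finset.sum_bij' (fun x _ => ⟨x.1.erase x.2, x.2⟩) (fun x _ => ⟨insert x.2 x.1, x.2⟩)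
      ?_ ?_ ?_ ?_ ?_
    · rintro ⟨T, i⟩ hx
      simp only [Finset.mem_sigma, Finset.mem_powersetCard, Finset.mem_sdiff] at hx ⊢
      obtain ⟨⟨hT, hc⟩, hi⟩ := hx
      refine ⟨⟨(Finset.erase_subset _ _).trans hT, ?_⟩, hT hi, Finset.notMem_erase _ _⟩
      rw [Finset.card_erase_of_mem hi, hc, Nat.add_sub_cancel]
    · rintro ⟨U, i⟩ hx
      simp only [Finset.mem_sigma, Finset.mem_powersetCard, Finset.mem_sdiff] at hx ⊢
      obtain ⟨⟨hU, hc⟩, hi, hiU⟩ := hx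
      refine ⟨⟨Finset.insert_subset hi hU, ?_⟩, Finset.mem_insert_self _ _⟩
      rw [Finset.card_insert_of_notMem hiU, hc]
    · rintro ⟨T, i⟩ hx
      simp only [Finset.mem_sigma] at hx
      simp [Finset.insert_erase hx.2]
    · rintro ⟨U, i⟩ hx
      simp only [Finset.mem_sigma, Finset.mem_sdiff] at hx
      simp [Finset.erase_insert hx.2.2]
    · rintro ⟨T, i⟩ hx
      simp only [Finset.mem_sigma] at hx
      simp [Finset.insert_erase hx.2]
  rw [h1, h2]
  refine Finset.sum_eq_zero fun U hU => ?_
  rw [← Finset.sum_mul, ← map_sum, h U hU, C_0, zero_mul]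

/-- Derivations kill products of forms they kill, so only degrees need checking. -/
theorem exists_dual_form [CharZero K] {r : ℕ} (hσ : Fintype.card σ = 2 * r + 4) (p : σ → K)
    (k : ℕ) : ∃ F : MvPolynomial σ K, F ≠ 0 ∧
      F.IsHomogeneous ((r + 1) * (k * (2 * r + 4) + 1)) ∧
      (∀ i, degreeOf i F ≤ k * (2 * r + 3) + 1) ∧
      directional (fun _ => 1) F = 0 ∧ directional p F = 0 := by
  have hcard : ∀ i : σ, (Finset.univ.erase i).card = 2 * r + 3 := by
    intro i
    rw [Finset.card_erase_of_mem (Finset.mem_univ i), Finset.card_univ, hσ]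
    omega
  choose f hf T hT hfT using fun i : σ => exists_isInvariantFamily (hcard i) p
  let Q : σ → MvPolynomial σ K := fun i => multilinearForm (Finset.univ.erase i) r (f i)
  have hQ0 : ∀ i, Q i ≠ 0 := fun i => multilinearForm_ne_zero (hT i) (hfT i)
  have hQd : ∀ i j, degreeOf j (Q i) ≤ if j ∈ Finset.univ.erase i then 1 else 0 :=
    fun i j => degreeOf_multilinearForm_le _ _ _ _
  obtain ⟨i₀⟩ : Nonempty σ := Fintype.card_pos_iff.1 (by omega)
  have hdir : ∀ w : σ → K, (∀ i, directional w (Q i) = 0) →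
      directional w ((∏ i, Q i) ^ k * Q i₀) = 0 := by
    intro w hw
    have h1 : directional w (∏ i, Q i) = 0 :=
      Finset.prod_induction _ (fun q => directional w q = 0)
        (fun a b ha hb => by rw [Derivation.leibniz, ha, hb, smul_zero, smul_zero, add_zero])
        (Derivation.map_one_eq_zero _) fun i _ => hw i
    rw [Derivation.leibniz, Derivation.leibniz_pow, h1, hw]
    simp
  refine ⟨(∏ i, Q i) ^ k * Q i₀, ?_, ?_, ?_, hdir _ fun i => ?_, hdir _ fun i => ?_⟩
  · exact mul_ne_zero (pow_ne_zero _ (Finset.prod_ne_zero_iff.2 fun i _ => hQ0 i)) (hQ0 i₀)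
  · have h1 : (∏ i, Q i).IsHomogeneous (∑ _i : σ, (r + 1)) :=
      IsHomogeneous.prod _ _ _ fun i _ => multilinearForm_isHomogeneous _ _ _
    have h2 := (h1.pow k).mul (multilinearForm_isHomogeneous (Finset.univ.erase i₀) r (f i₀))
    convert! h2 using 1
    rw [Finset.sum_const, Finset.card_univ, hσ, smul_eq_mul]
    ring
  · intro j
    -- The variable `j` is absent from `Q j` and has degree at most one in each of the other `2 * r
    -- + 3` factors.
    have h1 : degreeOf j (∏ i, Q i) ≤ 2 * r + 3 := by
      refine (degreeOf_prod_le _ _ _).trans ((Finset.sum_le_sum fun i _ => hQd i j).trans ?_)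
      rw [← hcard j, Finset.card_eq_sum_ones, ← Finset.sum_filter]
      refine Finset.sum_le_sum_of_subset fun i hi => ?_
      simp only [Finset.mem_filter, Finset.mem_erase, Finset.mem_univ, true_and, and_true] at hi ⊢
      exact hi.symm
    have h2 : degreeOf j (Q i₀) ≤ 1 := (hQd i₀ j).trans (by split_ifs <;> norm_num)
    refine (degreeOf_mul_le _ _ _).trans (Nat.add_le_add ((degreeOf_pow_le _ _ _).trans ?_) h2)
    exact Nat.mul_le_mul_left k h1
  · exact directional_multilinearForm fun U hU => by simpa using (hf i U hU).1
  · exact directional_multilinearForm fun U hU => (hf i U hU).2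

end DualForm

/-! ### Apolarity -/

section Apolarity

variable {σ K : Type*} [Field K] [Fintype σ]

/-- The pairing `G(∂) F` at the origin. -/
noncomputable def apolarPairing (F : MvPolynomial σ K) : MvPolynomial σ K →ₗ[K] K :=
  ∑ u ∈ F.support, ((∏ i, (u i).factorial : ℕ) * coeff u F) • lcoeff K u

theorem apolarPairing_apply (F G : MvPolynomial σ K) :
    apolarPairing F G =
      ∑ u ∈ F.support, ((∏ i, (u i).factorial : ℕ) * coeff u F) * coeff u G := by
  simp [apolarPairing, LinearMap.sum_apply]

theorem apolarPairing_monomial (F : MvPolynomial σ K) (u : σ →₀ ℕ) (c : K) :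
    apolarPairing F (monomial u c) = (∏ i, (u i).factorial : ℕ) * coeff u F * c := by
  classical
  rw [apolarPairing_apply]
  simp only [coeff_monomial, mul_ite, mul_zero, Finset.sum_ite_eq]
  split_ifs with h
  · rfl
  · rw [notMem_support_iff.1 h]; simp

/-- Multiplication by `∑ w_i x_i` is adjoint to `∑ w_i ∂_i`; the factorials in the pairing absorb
the exponents. -/
theorem apolarPairing_linForm_mul {F : MvPolynomial σ K} {w : σ → K} (h : directional w F = 0)
    (G : MvPolynomial σ K) : apolarPairing F (linForm w * G) = 0 := by
  classical
  induction G using MvPolynomial.induction_on' with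
  | add p q hp hq => rw [mul_add, map_add, hp, hq, add_zero]
  | monomial u c =>
    have h1 := congrArg (coeff u) h
    rw [directional_apply, coeff_sum, coeff_zero] at h1
    have h2 : ∀ i, apolarPairing F (C (w i) * X i * monomial u c) =
        (∏ i, (u i).factorial : ℕ) * c * coeff u (C (w i) * pderiv i F) := by
      intro i
      have e : C (w i) * X i * monomial u c = monomial (u + Finsupp.single i 1) (w i * c) := by
        rw [X, C_mul_monomial, monomial_mul, mul_one, add_comm]
      have hfac : ∏ j, ((u + Finsupp.single i 1 : σ →₀ ℕ) j).factorial =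
          (u i + 1) * ∏ j, (u j).factorial := by
        rw [← Finset.mul_prod_erase _ _ (Finset.mem_univ i),
          ← Finset.mul_prod_erase _ (fun j => (u j).factorial) (Finset.mem_univ i), ← mul_assoc]
        congr 1
        · simp [Nat.factorial_succ]
        · refine Finset.prod_congr rfl fun j hj => ?_
          rw [Finsupp.add_apply, Finsupp.single_eq_of_ne (Finset.ne_of_mem_erase hj), add_zero]
      rw [e, apolarPairing_monomial, hfac, coeff_C_mul, coeff_pderiv]
      push_cast
      ring
    rw [linForm, Finset.sum_mul, map_sum, Finset.sum_congr rfl fun i _ => h2 i, ← Finset.mul_sum,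
      h1, mul_zero]

theorem apolarPairing_eq_zero_of_mem {F G : MvPolynomial σ K} {d : ℕ}
    (hF : ∀ i, degreeOf i F < d) (hG : G ∈ varPowIdeal σ K d) : apolarPairing F G = 0 := by
  rw [apolarPairing_apply]
  refine Finset.sum_eq_zero fun u hu => ?_
  rw [mem_varPowIdeal_iff.1 hG u fun i => (monomial_le_degreeOf i hu).trans_lt (hF i), mul_zero]

/-- The ideal of forms `G` with `G(∂) F = 0`. -/
noncomputable def apolarIdeal (F : MvPolynomial σ K) : Ideal (MvPolynomial σ K) where
  carrier := {G | ∀ H, apolarPairing F (H * G) = 0}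
  add_mem' ha hb H := by rw [mul_add, map_add, ha, hb, add_zero]
  zero_mem' H := by rw [mul_zero, map_zero]
  smul_mem' c G hG H := by rw [smul_eq_mul, ← mul_assoc]; exact hG _

theorem linForm_mem_apolarIdeal {F : MvPolynomial σ K} {w : σ → K} (h : directional w F = 0) :
    linForm w ∈ apolarIdeal F := fun H => by
  rw [mul_comm]; exact apolarPairing_linForm_mul h H

theorem varPowIdeal_le_apolarIdeal {F : MvPolynomial σ K} {d : ℕ} (hF : ∀ i, degreeOf i F < d) :
    varPowIdeal σ K d ≤ apolarIdeal F := fun _ hG H =>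
  apolarPairing_eq_zero_of_mem hF (Ideal.mul_mem_left _ H hG)

/-- Any monomial of `F` pairs with `F` to a factorial product times its coefficient, nonzero in
characteristic zero. -/
theorem exists_monomial_notMem_apolarIdeal [CharZero K] {F : MvPolynomial σ K} (hF : F ≠ 0)
    {j : ℕ} (hj : F.IsHomogeneous j) :
    ∃ u : σ →₀ ℕ, u.degree = j ∧ monomial u 1 ∉ apolarIdeal F := by
  obtain ⟨u, hu⟩ := support_nonempty.2 hF
  refine ⟨u, ?_, fun h => ?_⟩
  · by_contra h
    exact mem_support_iff.1 hu (hj.coeff_eq_zero h)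
  · have h1 := h 1
    rw [one_mul, apolarPairing_monomial, mul_one, mul_eq_zero, Nat.cast_eq_zero,
      Finset.prod_eq_zero_iff] at h1
    rcases h1 with ⟨i, -, h1⟩ | h1
    · exact Nat.factorial_ne_zero _ h1
    · exact mem_support_iff.1 hu h1

end Apolarity

/-! ### Failure of surjectivity -/

section NotSurjective

variable {K : Type*} [Field K] {m : ℕ}

/-- The substitution `x_i ↦ a_i⁻¹ z_i`. -/
noncomputable def rescale (a : Fin m → K) :
    MvPolynomial (Fin m) K →ₐ[K] MvPolynomial (Option (Fin m)) K :=
  aeval fun i => C (a i)⁻¹ * X (some i)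

/-- The substitution `z_i ↦ a_i x_i`, `z_∞ ↦ -∑ a_i x_i`. -/
noncomputable def descale (a : Fin m → K) :
    MvPolynomial (Option (Fin m)) K →ₐ[K] MvPolynomial (Fin m) K :=
  aeval fun o => o.elim (-linForm a) fun i => C (a i) * X i

theorem rescale_linForm (a c : Fin m → K) :
    rescale a (linForm c) = linForm fun o : Option (Fin m) => o.elim 0 fun i => c i / a i := by
  rw [linForm, linForm, Fintype.sum_option, map_sum]
  simp only [Option.elim, C_0, zero_mul, zero_add]
  refine Finset.sum_congr rfl fun i _ => ?_
  rw [rescale, map_mul, aeval_X, aeval_C, algebraMap_eq, div_eq_mul_inv,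
    C_mul, mul_assoc]

theorem rescale_linForm_self {a : Fin m → K} (ha : ∀ i, a i ≠ 0) :
    rescale a (linForm a) = linForm (fun _ : Option (Fin m) => (1 : K)) - X none := by
  rw [rescale_linForm, linForm, linForm, Fintype.sum_option, Fintype.sum_option]
  simp [div_self (ha _)]

theorem rescale_mem {a : Fin m → K} (ha : ∀ i, a i ≠ 0) {d : ℕ}
    {J : Ideal (MvPolynomial (Option (Fin m)) K)} (h1 : varPowIdeal _ K d ≤ J)
    (h2 : linForm (fun _ : Option (Fin m) => (1 : K)) ∈ J) {f : MvPolynomial (Fin m) K}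
    (hf : f ∈ almostCIIdeal a d) : rescale a f ∈ J := by
  have hX : ∀ o : Option (Fin m), (X o : MvPolynomial _ K) ^ d ∈ J :=
    fun o => h1 (Ideal.subset_span ⟨o, rfl⟩)
  suffices h : almostCIIdeal a d ≤ J.comap (rescale a) from h hf
  rw [almostCIIdeal, Ideal.span_le, Set.union_subset_iff]
  constructor
  · rintro _ ⟨i, rfl⟩
    change rescale a (X i ^ d) ∈ J
    rw [map_pow, rescale, aeval_X, mul_pow]
    exact Ideal.mul_mem_left _ _ (hX _)
  · rintro _ rfl
    change rescale a (linForm a ^ d) ∈ J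
    rw [map_pow, rescale_linForm_self ha]
    have h3 : (-X none : MvPolynomial (Option (Fin m)) K) ^ d ∈ J := by
      rw [neg_pow]; exact Ideal.mul_mem_left _ _ (hX none)
    -- With `s = ∑ z_o`, the image of `L` is `s - z_∞`, so `L ^ d` maps to `(-z_∞) ^ d` modulo `s`.
    have h4 := sub_dvd_pow_sub_pow (linForm (fun _ : Option (Fin m) => (1 : K)) - X none)
      (-X none) d
    rw [sub_neg_eq_add, sub_add_cancel] at h4
    simpa using J.add_mem (J.mem_of_dvd h4 h2) h3

theorem rescale_descale_sub_mem {a : Fin m → K} (ha : ∀ i, a i ≠ 0)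
    {J : Ideal (MvPolynomial (Option (Fin m)) K)}
    (h : linForm (fun _ : Option (Fin m) => (1 : K)) ∈ J) (g : MvPolynomial (Option (Fin m)) K) :
    rescale a (descale a g) - g ∈ J := by
  have : ((Ideal.Quotient.mkₐ K J).comp (rescale a)).comp (descale a) =
      Ideal.Quotient.mkₐ K J := by
    refine algHom_ext fun o => ?_
    rw [AlgHom.comp_apply, AlgHom.comp_apply, descale, aeval_X]
    cases o with
    | none =>
      rw [Option.elim, map_neg, rescale_linForm_self ha, neg_sub, map_sub]
      exact sub_eq_self.2 (Ideal.Quotient.eq_zero_iff_mem.2 h)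
    | some i =>
      rw [Option.elim, map_mul, rescale, aeval_X, aeval_C, algebraMap_eq,
        ← mul_assoc, ← C_mul, mul_inv_cancel₀ (ha i), C_1, one_mul]
  exact Ideal.Quotient.eq.1 (DFunLike.congr_fun this g)

theorem descale_isHomogeneous (a : Fin m → K) {j : ℕ} {g : MvPolynomial (Option (Fin m)) K}
    (hg : g.IsHomogeneous j) : (descale a g).IsHomogeneous j := by
  have := hg.aeval (fun o => o.elim (-linForm a) fun i => C (a i) * X i) (n := 1) fun o => by
    cases o with
    | none => exact (linForm_isHomogeneous a).neg
    | some i => exact isHomogeneous_C_mul_X (a i) i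
  simpa [descale] using this

/-- Multiplication by a linear form is not surjective onto degree `(r + 1) (k (2 r + 4) + 1)`. -/
theorem not_surjective [CharZero K] {r k d j : ℕ} (hd : d = k * (2 * r + 3) + 2)
    (hj : j = (r + 1) * (k * (2 * r + 4) + 1)) {a : Fin (2 * r + 3) → K} (ha : ∀ i, a i ≠ 0)
    {ℓ : MvPolynomial (Fin (2 * r + 3)) K ⧸ almostCIIdeal a d}
    (hℓ : ℓ ∈ quotientComponent (almostCIIdeal a d) 1) :
    ¬ ∀ y ∈ quotientComponent (almostCIIdeal a d) j, ∃ x, ℓ * x = y := by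
  intro hsurj
  obtain ⟨ℓ₀, hℓ₀, rfl⟩ := hℓ
  rw [SetLike.mem_coe, homogeneousSubmodule_one_eq_span_X, Submodule.mem_span_range_iff_exists_fun]
    at hℓ₀
  obtain ⟨c, rfl⟩ := hℓ₀
  have hc : ∑ i, c i • (X i : MvPolynomial (Fin (2 * r + 3)) K) = linForm c := by
    simp [linForm, smul_eq_C_mul]
  rw [hc] at hsurj
  obtain ⟨F, hF0, hFh, hFd, hF1, hFp⟩ := exists_dual_form (r := r)
    (σ := Option (Fin (2 * r + 3))) (by simp) (fun o => o.elim 0 fun i => c i / a i) k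
  obtain ⟨u, hu, huF⟩ := exists_monomial_notMem_apolarIdeal hF0 hFh
  have hsum := linForm_mem_apolarIdeal hF1
  have hle := varPowIdeal_le_apolarIdeal (F := F) (d := d) fun i => (hFd i).trans_lt (by omega)
  have hg : (descale a (monomial u 1)).IsHomogeneous j :=
    descale_isHomogeneous a (isHomogeneous_monomial _ (hu.trans hj.symm))
  obtain ⟨x, hx⟩ := hsurj _ ⟨_, hg, rfl⟩
  obtain ⟨h, rfl⟩ := Ideal.Quotient.mk_surjective x
  have h1 : linForm c * h - descale a (monomial u 1) ∈ almostCIIdeal a d := Ideal.Quotient.eq.1 hx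
  have h2 := rescale_mem ha hle hsum h1
  rw [map_sub, map_mul, rescale_linForm] at h2
  -- The image of `ℓ * h` lies in the apolar ideal of `F`; removing the two error terms shows that
  -- the chosen monomial does too.
  have h3 := Ideal.sub_mem _ (Ideal.sub_mem _
    (Ideal.mul_mem_right (rescale a h) _ (linForm_mem_apolarIdeal hFp)) h2)
    (rescale_descale_sub_mem ha hsum (monomial u 1))
  rw [sub_sub_cancel, sub_sub_cancel] at h3
  exact huF h3

end NotSurjective

/-! ### The two failures combined -/

theorem theorem6p4 (n : ℕ) (hn : 8 ≤ n) (hn_even : Even n) :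
    ∃ N : ℕ, ∀ d : ℕ, 2 ≤ d → N ≤ d - 2 → (n + 1) ∣ (d - 2) →
      ∀ (K : Type*) [Field K] [CharZero K] (a : Fin (n + 1) → K), (∀ i, a i ≠ 0) →
        ¬ HasWeakLefschetzProperty (quotientComponent (uniformPowerIdeal (linearForm a) d)) := by
  obtain ⟨r, rfl⟩ : ∃ r, n = 2 * r + 2 := by
    obtain ⟨s, rfl⟩ := hn_even
    exact ⟨s - 1, by omega⟩
  -- The bound amounts to `k ≥ 3`, as the counting inequality requires.
  refine ⟨3 * (2 * r + 3), fun d hd2 hN hdvd K _ _ a ha => ?_⟩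
  obtain ⟨k, hk⟩ := hdvd
  rw [show 2 * r + 2 + 1 = 2 * r + 3 by ring] at hk
  have hk3 : 3 ≤ k := by
    rw [hk, mul_comm] at hN
    exact Nat.le_of_mul_le_mul_left hN (by omega)
  have hd : d = k * (2 * r + 3) + 2 := by rw [mul_comm, ← hk]; omega
  have hr : 3 ≤ r := by omega
  obtain ⟨e, he⟩ : ∃ e, (r + 1) * (k * (2 * r + 4) + 1) = e + 1 + d := by
    refine ⟨(r + 1) * (k * (2 * r + 4) + 1) - 1 - d, ?_⟩
    have h1 : d + 1 ≤ (r + 1) * (k * (2 * r + 4) + 1) := by rw [hd]; nlinarith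
    omega
  rintro ⟨ℓ, hℓ, hmax⟩
  change ℓ ∈ quotientComponent (almostCIIdeal a d) 1 at hℓ
  rcases hmax (e + d) with hinj | hsurj
  · refine not_injective_of_card_lt ha (by omega) ?_ ?_ hℓ hinj
    · obtain ⟨q, rfl⟩ : ∃ q, d = q + 1 := ⟨d - 1, by omega⟩
      rw [Nat.add_sub_cancel]
      nlinarith
    · have h := boxCount_difference_lt (s := r + 1) (k := k) (d := d) (by omega) hk3
        (by rw [hd]; ring) (j := ((r + 1) * (k * (2 * r + 4) + 1) : ℕ)) (by push_cast; ring)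
      rw [he] at h
      rw [show ((e + 1 + d : ℕ) : ℤ) - 1 - d = (e : ℕ) by push_cast; ring,
        show ((e + 1 + d : ℕ) : ℤ) - 1 = (e + d : ℕ) by push_cast; ring,
        show ((e + 1 + d : ℕ) : ℤ) - d = (e + 1 : ℕ) by push_cast; ring] at h
      simp only [← card_boxExponents] at h
      exact_mod_cast h
  · refine not_surjective hd (j := e + d + 1) (by rw [he]; ring) ha hℓ fun y hy => ?_
    obtain ⟨x, -, hx⟩ := hsurj y hy
    exact ⟨x, hx⟩
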